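/- Call an infinite set $C\subseteq\mathbb N$ cohesive if for every c.e. set $W$, either $C\subseteq^* W$ or $C\subseteq^*\mathbb N\setminus W$ (where $X\subseteq^* Y$ means that $X\setminus Y$ is finite). A computable linear order is a pair $\mathcal L=(L,\prec_{\mathcal L})$ with $L\subseteq\mathbb N$ non-empty and computable and $\prec_{\mathcal L}$ a computable strict linear order on $L$. Its cohesive power $\Pi_C\mathcal L$ has as elements the classes $[\varphi]$ of partial computable functions $\varphi:\mathbb N\to L$ with $C\subseteq^*\operatorname{dom}(\varphi)$, where $[\varphi]=[\psi]$ if and only if $C\subseteq^*\{x:\varphi(x){\downarrow}=\psi(x){\downarrow}\}$, and is ordered by $[\varphi]\prec[\psi]$ if and only if $C\subseteq^*\{x:\varphi(x){\downarrow},\ \psi(x){\downarrow},\ \varphi(x)\prec_{\mathcal L}\psi(x)\}$. A theorem of Dimitrov says that if $C$ is cohesive, $\mathcal A$ is a computable structure and $\Phi$ is a $\Pi_3$ sentence with $\Pi_C\mathcal A\models\Phi$, then $\mathcal A\models\Phi$. This cannot be improved from $\Pi_3$ to $\Sigma_3$ sentences: there are a cohesive set $C$, a computable linear order $\mathcal L$,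 and a $\Sigma_3$ sentence $\Phi$ in the language $\{\prec\}$ of linear orders, expressing "some element has no immediate successor", such that $\Pi_C\mathcal L\models\Phi$ but $\mathcal L\not\models\Phi$. Here $y$ is an immediate successor of $x$ if $x\prec y$ and there is no $z$ with $x\prec z\prec y$. -/

import Mathlib

open scoped FirstOrder

/-- `C ⊆* X`: all but finitely many elements of `C` belong to `X`. -/
def AlmostSubset (C X : Set ℕ) : Prop := (C \ X).Finite

/-- An infinite set `C ⊆ ℕ` is cohesive if for every c.e. set `W`, either `C ⊆* W` or
`C ⊆* Wᶜ`. -/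
def IsCohesive (C : Set ℕ) : Prop :=
  C.Infinite ∧ ∀ W : Set ℕ, REPred (fun n => n ∈ W) → AlmostSubset C W ∨ AlmostSubset C Wᶜ

theorem AlmostSubset.mono {C X Y : Set ℕ} (h : AlmostSubset C X) (hXY : X ⊆ Y) :
    AlmostSubset C Y :=
  Set.Finite.subset h fun _ hn => ⟨hn.1, fun hX => hn.2 (hXY hX)⟩

theorem AlmostSubset.inter {C X Y : Set ℕ} (hX : AlmostSubset C X) (hY : AlmostSubset C Y) :
    AlmostSubset C (X ∩ Y) := by
  refine Set.Finite.subset (Set.Finite.union hX hY) fun n hn => ?_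
  by_cases h : n ∈ X
  · exact Or.inr ⟨hn.1, fun hY => hn.2 ⟨h, hY⟩⟩
  · exact Or.inl ⟨hn.1, h⟩

/-- The relation symbols of the language of (strict) linear orders: one binary symbol. -/
inductive StrictOrderRel : ℕ → Type
  | lt : StrictOrderRel 2

/-- The first-order language of (strict) linear orders. -/
def strictOrderLang : FirstOrder.Language.{0, 0} := ⟨fun _ => Empty, StrictOrderRel⟩

/-- A binary relation `r` on `M` as a structure for the language of linear orders. -/
abbrev relStructure {M : Type*} (r : M → M → Prop) : strictOrderLang.Structure M where
  funMap := fun f _ => f.elim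
  RelMap := fun
    | StrictOrderRel.lt, v => r (v 0) (v 1)

/-- `y` is an immediate successor of `x` with respect to the strict order `r`. -/
def IsImmediateSuccessor {M : Type*} (r : M → M → Prop) (x y : M) : Prop :=
  r x y ∧ ¬ ∃ z, r x z ∧ r z y

mutual
/-- `Σ_k` formulas: for `k = 0` the quantifier-free formulas; for `k + 1` a (possibly empty) block
of existential quantifiers in front of a `Π_k` formula. -/
inductive IsSigmaFormula {L : FirstOrder.Language.{0, 0}} {α : Type} :
    ℕ → ∀ {n : ℕ}, L.BoundedFormula α n → Prop
  | qf {n : ℕ} {φ : L.BoundedFormula α n} : φ.IsQF → IsSigmaFormula 0 φ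
  | ofPi {k n : ℕ} {φ : L.BoundedFormula α n} : IsPiFormula k φ → IsSigmaFormula (k + 1) φ
  | ex {k n : ℕ} {φ : L.BoundedFormula α (n + 1)} :
      IsSigmaFormula (k + 1) φ → IsSigmaFormula (k + 1) φ.ex

/-- `Π_k` formulas: for `k = 0` the quantifier-free formulas; for `k + 1` a (possibly empty) block
of universal quantifiers in front of a `Σ_k` formula. -/
inductive IsPiFormula {L : FirstOrder.Language.{0, 0}} {α : Type} :
    ℕ → ∀ {n : ℕ}, L.BoundedFormula α n → Prop
  | qf {n : ℕ} {φ : L.BoundedFormula α n} : φ.IsQF → IsPiFormula 0 φ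
  | ofSigma {k n : ℕ} {φ : L.BoundedFormula α n} : IsSigmaFormula k φ → IsPiFormula (k + 1) φ
  | all {k n : ℕ} {φ : L.BoundedFormula α (n + 1)} :
      IsPiFormula (k + 1) φ → IsPiFormula (k + 1) φ.all
end

/-- A computable linear order: a non-empty computable domain `dom ⊆ ℕ` with a computable strict
linear order `lt` on it (the values of `lt` outside `dom` play no role). -/
structure ComputableLinearOrder where
  dom : Set ℕ
  lt : ℕ → ℕ → Prop
  dom_nonempty : dom.Nonempty
  dom_computable : ComputablePred (fun n => n ∈ dom)
  lt_computable : ComputablePred (fun p : ℕ × ℕ => lt p.1 p.2)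
  lt_irrefl : ∀ a ∈ dom, ¬ lt a a
  lt_trans : ∀ a ∈ dom, ∀ b ∈ dom, ∀ c ∈ dom, lt a b → lt b c → lt a c
  lt_total : ∀ a ∈ dom, ∀ b ∈ dom, lt a b ∨ a = b ∨ lt b a

namespace ComputableLinearOrder

variable (L : ComputableLinearOrder) (C : Set ℕ)

/-- The domain of `L` as a type. -/
def Carrier : Type := {n : ℕ // n ∈ L.dom}

instance : strictOrderLang.Structure L.Carrier :=
  relStructure fun a b : {n : ℕ // n ∈ L.dom} => L.lt a.1 b.1

/-- The partial computable functions `φ : ℕ → dom L` with `C ⊆* dom φ`. -/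
structure PreCohesivePower where
  toPFun : ℕ →. ℕ
  partrec : Partrec toPFun
  mem_dom : ∀ n, ∀ a ∈ toPFun n, a ∈ L.dom
  almost_defined : AlmostSubset C toPFun.Dom

/-- `φ =_C ψ`: `φ(x)` and `ψ(x)` are defined and equal for almost all `x ∈ C`. -/
instance cohesiveSetoid : Setoid (L.PreCohesivePower C) where
  r φ ψ := AlmostSubset C {x | ∃ a, a ∈ φ.toPFun x ∧ a ∈ ψ.toPFun x}
  iseqv :=
    { refl := fun φ => φ.almost_defined.mono fun x hx => by
        obtain ⟨a, ha⟩ := (PFun.mem_dom _ _).1 hx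
        exact ⟨a, ha, ha⟩
      symm := fun h => h.mono fun _ ⟨a, h₁, h₂⟩ => ⟨a, h₂, h₁⟩
      trans := fun h h' => (h.inter h').mono fun _ ⟨⟨a, h₁, h₂⟩, ⟨b, h₃, h₄⟩⟩ => by
        have hab : a = b := Part.mem_unique h₂ h₃
        subst hab
        exact ⟨a, h₁, h₄⟩ }

/-- The (domain of the) cohesive power `Π_C L`: the set of `=_C`-classes. -/
def CohesivePower : Type := Quotient (L.cohesiveSetoid C)

/-- The order on representatives: `φ(x)` and `ψ(x)` are defined with `φ(x) ≺ ψ(x)`, for almost all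
`x ∈ C`. -/
def preLT (φ ψ : L.PreCohesivePower C) : Prop :=
  AlmostSubset C {x | ∃ a b, a ∈ φ.toPFun x ∧ b ∈ ψ.toPFun x ∧ L.lt a b}

theorem preLT_of_equiv {φ ψ φ' ψ' : L.PreCohesivePower C} (h₁ : φ ≈ φ') (h₂ : ψ ≈ ψ')
    (h : L.preLT C φ ψ) : L.preLT C φ' ψ' := by
  refine (AlmostSubset.inter (AlmostSubset.inter h₁ h₂) h).mono ?_
  rintro x ⟨⟨⟨a, ha, ha'⟩, ⟨b, hb, hb'⟩⟩, ⟨c, d, hc, hd, hcd⟩⟩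
  have hac : a = c := Part.mem_unique ha hc
  have hbd : b = d := Part.mem_unique hb hd
  subst hac hbd
  exact ⟨a, b, ha', hb', hcd⟩

/-- The order relation of the cohesive power. -/
def cohesiveLT (p q : L.CohesivePower C) : Prop :=
  Quotient.liftOn₂ p q (L.preLT C) fun _ _ _ _ h₁ h₂ =>
    propext ⟨L.preLT_of_equiv C h₁ h₂,
      L.preLT_of_equiv C (Setoid.symm h₁) (Setoid.symm h₂)⟩

instance : strictOrderLang.Structure (L.CohesivePower C) :=
  relStructure (L.cohesiveLT C)

end ComputableLinearOrder

-- Take a sum, over `x : ℕ`, of finite blocks, so every element of the order has an immediate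
-- successor. Block `x` starts with `(x, 0)` and records which programs `e < x` halt on `x`; storing
-- the halting stage `s` keeps the domain decidable, and larger codes come earlier within the block.
-- In the cohesive power the class of `x ↦ (x, 0)` has no immediate successor. If `ψ` lies above it
-- and program `e` computes `ψ`, then for almost all `x ∈ C` the entry `(x, ⟨e, s⟩ + 1)` lies
-- strictly between `(x, 0)` and `ψ x`, because the stage `s` exceeds the output `ψ x`. A search for
-- such an element is partial computable (`exists_between_haltingBlocks`). This works for every `C`;
-- cohesiveness comes only from `exists_isCohesive`.

open FirstOrder Language

-- The sentence

/-- The `Σ₃` sentence `∃ x, ∀ y, ∃ z, (x ≺ y → x ≺ z ∧ z ≺ y)`. -/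
def noImmediateSuccessorSentence : strictOrderLang.Sentence :=
  BoundedFormula.ex (BoundedFormula.all (BoundedFormula.ex
    ((Relations.boundedFormula₂ (L := strictOrderLang) StrictOrderRel.lt (&0) (&1)).imp
      (Relations.boundedFormula₂ (L := strictOrderLang) StrictOrderRel.lt (&0) (&2) ⊓
        Relations.boundedFormula₂ (L := strictOrderLang) StrictOrderRel.lt (&2) (&1)))))

theorem isSigmaFormula_noImmediateSuccessorSentence :
    IsSigmaFormula 3 noImmediateSuccessorSentence := by
  refine .ex (.ofPi (.all (.ofSigma (.ex (.ofPi (.qf ?_))))))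
  refine (BoundedFormula.IsAtomic.isQF ?_).imp (BoundedFormula.IsQF.inf ?_ ?_)
  · exact .rel _ _
  · exact .of_isAtomic (.rel _ _)
  · exact .of_isAtomic (.rel _ _)

theorem realize_noImmediateSuccessorSentence (M : Type) (r : M → M → Prop) :
    @FirstOrder.Language.Sentence.Realize strictOrderLang M (relStructure r)
      noImmediateSuccessorSentence ↔ ∃ x : M, ¬ ∃ y : M, IsImmediateSuccessor r x y := by
  let := relStructure r
  have : @FirstOrder.Language.Sentence.Realize strictOrderLang M (relStructure r)
      noImmediateSuccessorSentence ↔ ∃ x : M, ∀ y, ∃ z, (r x y → r x z ∧ r z y) := by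
    simp only [noImmediateSuccessorSentence, Sentence.Realize, Formula.Realize,
      BoundedFormula.realize_ex, BoundedFormula.realize_all, BoundedFormula.realize_imp,
      BoundedFormula.realize_inf]
    rfl
  rw [this]
  refine exists_congr fun x => ?_
  simp only [IsImmediateSuccessor, not_exists, not_and, not_forall, not_not]
  refine forall_congr' fun y => ⟨fun ⟨z, hz⟩ h => ⟨z, (hz h).1, (hz h).2⟩, fun h => ?_⟩
  by_cases hxy : r x y
  · obtain ⟨z, h₁, h₂⟩ := h hxy
    exact ⟨z, fun _ => ⟨h₁, h₂⟩⟩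
  -- The implication is vacuous here, but the prenex `∃ z` still needs some witness.
  · exact ⟨x, fun h => absurd h hxy⟩

-- Existence of cohesive sets

open Nat.Partrec (Code) in
-- A nonprincipal ultrafilter `U` chooses, for each c.e. set, that set or its complement; `A e` is
-- the choice for the `e`-th one. Finite intersections of choices are in `U`, hence infinite, so an
-- increasing `f` with `f n ∈ A e` for all `e ≤ n` exists.
theorem exists_isCohesive : ∃ C : Set ℕ, IsCohesive C := by
  classical
  let U : Ultrafilter ℕ := Filter.hyperfilter ℕ
  let A : ℕ → Set ℕ := fun e => {n | n ∈ ((Code.eval (Denumerable.ofNat Code e)).Dom : Set ℕ) ↔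
    ((Code.eval (Denumerable.ofNat Code e)).Dom : Set ℕ) ∈ U}
  have hA : ∀ e, A e ∈ U := fun e => by
    by_cases h : ((Code.eval (Denumerable.ofNat Code e)).Dom : Set ℕ) ∈ U
    · filter_upwards [h] with n hn
      exact ⟨fun _ => h, fun _ => hn⟩
    · filter_upwards [Ultrafilter.compl_mem_iff_notMem.2 h] with n hn
      exact ⟨fun h' => absurd h' hn, fun h' => absurd h' h⟩
  obtain ⟨f, hf, hfA⟩ := Filter.extraction_forall_of_frequently
    (P := fun n k => ∀ e ≤ n, k ∈ A e) fun n => by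
      have h : ∀ᶠ k in (U : Filter ℕ), ∀ e ≤ n, k ∈ A e :=
        (Set.finite_le_nat n).eventually_all.2 fun e _ => hA e
      exact h.frequently.filter_mono Nat.hyperfilter_le_atTop
  refine ⟨Set.range f, Set.infinite_range_of_injective hf.injective, fun W hW => ?_⟩
  obtain ⟨c, hc⟩ := Code.exists_code.1 (Partrec.nat_iff.1
    (Partrec.map hW (Computable.const 0).to₂))
  have hdom : (Code.eval (Denumerable.ofNat Code (Encodable.encode c))).Dom = W := by
    ext n
    rw [Denumerable.ofNat_encode, hc]
    simp [PFun.Dom, Part.assert]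
  set e := Encodable.encode c
  -- Only the values `f n` with `n < e` can lie outside `A e`.
  have hlate : ∀ X : Set ℕ, (∀ n ∈ A e, n ∈ X) → AlmostSubset (Set.range f) X := by
    intro X hX
    refine ((Set.finite_lt_nat e).image f).subset ?_
    rintro _ ⟨⟨n, rfl⟩, hn⟩
    refine ⟨n, ?_, rfl⟩
    by_contra h
    exact hn (hX _ (hfA n e (not_lt.1 h)))
  by_cases h : W ∈ U
  · exact .inl (hlate W fun n hn => by simp only [A, hdom] at hn; exact hn.2 h)
  · exact .inr (hlate Wᶜ fun n hn => by
      simp only [A, hdom] at hn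
      exact fun hnW => h (hn.1 hnW))

-- Halting stages

open Nat.Partrec

/-- The `e`-th program, run on input `x` for `s` steps, halts with an output below `s`. -/
def haltsBelow (e x s : ℕ) : Bool :=
  ((Code.evaln s (Denumerable.ofNat Code e) x).map fun y => decide (y < s)).getD false

theorem haltsBelow_iff {e x s : ℕ} :
    haltsBelow e x s = true ↔ ∃ y ∈ Code.evaln s (Denumerable.ofNat Code e) x, y < s := by
  unfold haltsBelow
  cases Code.evaln s (Denumerable.ofNat Code e) x <;> simp

theorem haltsBelow_mono {e x s t : ℕ} (hst : s ≤ t) (h : haltsBelow e x s = true) :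
    haltsBelow e x t = true := by
  obtain ⟨y, hy, hys⟩ := haltsBelow_iff.1 h
  exact haltsBelow_iff.2 ⟨y, Code.evaln_mono hst hy, hys.trans_le hst⟩

theorem haltsBelow_zero (e x : ℕ) : haltsBelow e x 0 = false := by
  simp [haltsBelow, Code.evaln]

theorem primrec_haltsBelow : Primrec fun p : (ℕ × ℕ) × ℕ => haltsBelow p.1.1 p.1.2 p.2 := by
  have h : Primrec fun p : (ℕ × ℕ) × ℕ =>
      Code.evaln p.2 (Denumerable.ofNat Code p.1.1) p.1.2 :=
    Code.primrec_evaln.comp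
      ((Primrec.snd.pair ((Primrec.ofNat Code).comp (Primrec.fst.comp Primrec.fst))).pair
        (Primrec.snd.comp Primrec.fst))
  exact Primrec.option_getD.comp
    (Primrec.option_map h
      (Primrec.nat_lt.decide.comp Primrec.snd (Primrec.snd.comp Primrec.fst)).to₂)
    (Primrec.const false)

/-- `s` is the first stage at which the `e`-th program halts on `x` with an output below `s`. -/
def FirstHalts (e x s : ℕ) : Prop :=
  haltsBelow e x s = true ∧ haltsBelow e x (s - 1) = false

theorem FirstHalts.le {e x s t : ℕ} (hs : FirstHalts e x s) (ht : haltsBelow e x t = true) :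
    s ≤ t := by
  by_contra! h
  have := haltsBelow_mono (show t ≤ s - 1 by omega) ht
  simp [hs.2] at this

/-- The bound `y < s` is what later places the entry for stage `s` before `y`. -/
theorem exists_firstHalts {e x y : ℕ} (h : y ∈ Code.eval (Denumerable.ofNat Code e) x) :
    ∃ s, FirstHalts e x s ∧ y < s := by
  classical
  have hex : ∃ s, haltsBelow e x s = true := by
    obtain ⟨k, hk⟩ := Code.evaln_complete.1 h
    exact ⟨max k (y + 1), haltsBelow_iff.2 ⟨y, Code.evaln_mono (le_max_left _ _) hk, by simp⟩⟩
  refine ⟨Nat.find hex, ⟨Nat.find_spec hex, ?_⟩, ?_⟩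
  -- Truncated subtraction gives `0 - 1 = 0`, so stage `0` is treated apart.
  · rcases Nat.eq_zero_or_pos (Nat.find hex) with h0 | h0
    · rw [h0]
      exact haltsBelow_zero e x
    · simpa using Nat.find_min hex (Nat.sub_lt h0 one_pos)
  · obtain ⟨z, hz, hzs⟩ := haltsBelow_iff.1 (Nat.find_spec hex)
    rwa [Part.mem_unique h (Code.evaln_sound hz)]

-- The computable order of finite blocks

/-- Elements are codes of pairs `(x, m)`. Block `x` has the first element `(x, 0)` and, for every
`e < x`, the element `(x, ⟨e, s⟩ + 1)` for the stage `s` at which the `e`-th program halts on `x`. -/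
def haltingBlocksDom : Set ℕ :=
  {n | n.unpair.2 = 0 ∨
    (n.unpair.2 - 1).unpair.1 < n.unpair.1 ∧
      FirstHalts (n.unpair.2 - 1).unpair.1 n.unpair.1 (n.unpair.2 - 1).unpair.2}

/-- Blocks are ordered by their index; within a block, `(x, 0)` comes first and the other elements
`(x, m)` are in decreasing order of `m`. -/
def haltingBlocksLT (a b : ℕ) : Prop :=
  a.unpair.1 < b.unpair.1 ∨
    a.unpair.1 = b.unpair.1 ∧ b.unpair.2 ≠ 0 ∧ (a.unpair.2 = 0 ∨ b.unpair.2 < a.unpair.2)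

theorem primrecPred_haltingBlocksDom : PrimrecPred fun n => n ∈ haltingBlocksDom := by
  have hx : Primrec fun n : ℕ => n.unpair.1 := Primrec.fst.comp Primrec.unpair
  have hm : Primrec fun n : ℕ => n.unpair.2 := Primrec.snd.comp Primrec.unpair
  have hq : Primrec fun n : ℕ => (n.unpair.2 - 1).unpair :=
    Primrec.unpair.comp (Primrec.pred.comp hm)
  have he := Primrec.fst.comp hq
  have hs := Primrec.snd.comp hq
  exact (Primrec.eq.comp hm (Primrec.const 0)).or
    ((Primrec.nat_lt.comp he hx).and
      ((Primrec.eq.comp (primrec_haltsBelow.comp ((he.pair hx).pair hs)) (Primrec.const true)).and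
        (Primrec.eq.comp (primrec_haltsBelow.comp ((he.pair hx).pair (Primrec.pred.comp hs)))
          (Primrec.const false))))

theorem primrecRel_haltingBlocksLT : PrimrecRel haltingBlocksLT := by
  have hx : Primrec fun p : ℕ × ℕ => p.1.unpair.1 :=
    Primrec.fst.comp (Primrec.unpair.comp Primrec.fst)
  have hy : Primrec fun p : ℕ × ℕ => p.2.unpair.1 :=
    Primrec.fst.comp (Primrec.unpair.comp Primrec.snd)
  have hm : Primrec fun p : ℕ × ℕ => p.1.unpair.2 :=
    Primrec.snd.comp (Primrec.unpair.comp Primrec.fst)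
  have hk : Primrec fun p : ℕ × ℕ => p.2.unpair.2 :=
    Primrec.snd.comp (Primrec.unpair.comp Primrec.snd)
  exact (Primrec.nat_lt.comp hx hy).or
    ((Primrec.eq.comp hx hy).and
      ((Primrec.eq.comp hk (Primrec.const 0)).not.and
        ((Primrec.eq.comp hm (Primrec.const 0)).or (Primrec.nat_lt.comp hk hm))))

/-- The computable linear order given by `haltingBlocksDom` and `haltingBlocksLT`. -/
def haltingBlocks : ComputableLinearOrder where
  dom := haltingBlocksDom
  lt := haltingBlocksLT
  dom_nonempty := ⟨Nat.pair 0 0, by simp [haltingBlocksDom]⟩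
  dom_computable := primrecPred_haltingBlocksDom.computablePred
  lt_computable := PrimrecPred.computablePred primrecRel_haltingBlocksLT
  lt_irrefl a _ := by unfold haltingBlocksLT; omega
  lt_trans a _ b _ c _ := by unfold haltingBlocksLT; omega
  lt_total a _ b _ := by
    have h : a = b ↔ a.unpair.1 = b.unpair.1 ∧ a.unpair.2 = b.unpair.2 := by
      rw [← Prod.ext_iff]
      exact Nat.pairEquiv.symm.injective.eq_iff.symm
    unfold haltingBlocksLT
    omega

/-- Each of the finitely many `e < x` contributes at most one entry, as the first halting stage is
unique. -/
theorem finite_haltingBlocks_block (x : ℕ) : {m | Nat.pair x m ∈ haltingBlocksDom}.Finite := by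
  have h : ∀ e, {s | FirstHalts e x s}.Finite := fun e =>
    Set.Subsingleton.finite fun s hs t ht => le_antisymm (hs.le ht.1) (ht.le hs.1)
  refine (((Set.finite_lt_nat x).biUnion fun e _ =>
    (h e).image fun s => Nat.pair e s + 1).insert 0).subset fun m hm => ?_
  rcases Nat.eq_zero_or_pos m with rfl | hpos
  · exact Set.mem_insert _ _
  · simp only [haltingBlocksDom, Set.mem_ofPred_eq, Nat.unpair_pair] at hm
    obtain hm | ⟨hlt, hs⟩ := hm
    · omega
    · refine Set.mem_insert_of_mem _ (Set.mem_biUnion hlt ⟨_, hs, ?_⟩)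
      simp only [Nat.pair_unpair]
      omega

-- Immediate successors in the order and in its cohesive powers

theorem exists_isImmediateSuccessor_haltingBlocks (a : ℕ) :
    ∃ b ∈ haltingBlocksDom, haltingBlocksLT a b ∧
      ¬ ∃ c ∈ haltingBlocksDom, haltingBlocksLT a c ∧ haltingBlocksLT c b := by
  let S : Set ℕ := {m | Nat.pair a.unpair.1 m ∈ haltingBlocksDom ∧
    haltingBlocksLT a (Nat.pair a.unpair.1 m)}
  have hS : S.Finite := (finite_haltingBlocks_block a.unpair.1).subset fun m hm => hm.1
  have key : ∀ c ∈ haltingBlocksDom, haltingBlocksLT a c → c.unpair.1 = a.unpair.1 →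
      c.unpair.2 ∈ S := fun c hc hac h => by
    have hcc : Nat.pair a.unpair.1 c.unpair.2 = c := by rw [← h, Nat.pair_unpair]
    simp only [S, Set.mem_ofPred_eq, hcc]
    exact ⟨hc, hac⟩
  rcases S.eq_empty_or_nonempty with hempty | hne
  · refine ⟨Nat.pair (a.unpair.1 + 1) 0, by simp [haltingBlocksDom],
      by simp [haltingBlocksLT], ?_⟩
    rintro ⟨c, hc, hac, hcb⟩
    have hne : c.unpair.1 ≠ a.unpair.1 := fun h => by simpa [hempty] using key c hc hac h
    simp only [haltingBlocksLT, Nat.unpair_pair] at hac hcb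
    omega
  -- Codes decrease along a block, so the largest code above `a` gives the least element above `a`.
  · obtain ⟨m, hm, hmax⟩ := hS.exists_maximal hne
    refine ⟨Nat.pair a.unpair.1 m, hm.1, hm.2, ?_⟩
    rintro ⟨c, hc, hac, hcb⟩
    have hmem := key c hc hac
    have hle : c.unpair.1 = a.unpair.1 → m ≤ c.unpair.2 → c.unpair.2 ≤ m :=
      fun h => hmax (hmem h)
    simp only [haltingBlocksLT, Nat.unpair_pair] at hac hcb
    omega

/-- The entry of `e` has code `⟨e, s⟩ + 1 > s > y ≥ y.unpair.2`, so it precedes `y` if `y` is in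
block `x`; otherwise `y` is in a later block. -/
theorem exists_between_haltingBlocks {e x y : ℕ} (hex : e < x)
    (hy : y ∈ Code.eval (Denumerable.ofNat Code e) x) (hlt : haltingBlocksLT (Nat.pair x 0) y) :
    ∃ c ∈ haltingBlocksDom, haltingBlocksLT (Nat.pair x 0) c ∧ haltingBlocksLT c y := by
  obtain ⟨s, hs, hys⟩ := exists_firstHalts hy
  refine ⟨Nat.pair x (Nat.pair e s + 1), ?_, by simp [haltingBlocksLT], ?_⟩
  · simp [haltingBlocksDom, hex, hs]
  · have h₁ := Nat.right_le_pair e s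
    have h₂ := Nat.unpair_right_le y
    simp only [haltingBlocksLT, Nat.unpair_pair] at hlt ⊢
    omega

theorem exists_no_immediateSuccessor_cohesivePower_haltingBlocks (C : Set ℕ) :
    ∃ p : haltingBlocks.CohesivePower C,
      ¬ ∃ q, IsImmediateSuccessor (haltingBlocks.cohesiveLT C) p q := by
  let φ : haltingBlocks.PreCohesivePower C :=
    { toPFun := fun x => Part.some (Nat.pair x 0)
      partrec := (Primrec₂.natPair.comp Primrec.id (Primrec.const 0)).to_comp
      mem_dom := fun n a ha => by
        rw [Part.mem_some_iff.1 ha]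
        simp [haltingBlocks, haltingBlocksDom]
      almost_defined := by simp [AlmostSubset, PFun.Dom] }
  refine ⟨Quotient.mk _ φ, fun ⟨q, hφq, hq⟩ => ?_⟩
  induction q using Quotient.inductionOn with | _ ψ
  obtain ⟨c, hc⟩ := Code.exists_code.1 (Partrec.nat_iff.1 ψ.partrec)
  let R : ℕ × ℕ → ℕ → Prop := fun p n =>
    n ∈ haltingBlocksDom ∧ haltingBlocksLT (Nat.pair p.1 0) n ∧ haltingBlocksLT n p.2
  have hR : PrimrecRel R := by
    have hx : Primrec fun p : (ℕ × ℕ) × ℕ => Nat.pair p.1.1 0 :=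
      Primrec₂.natPair.comp (Primrec.fst.comp Primrec.fst) (Primrec.const 0)
    exact (primrecPred_haltingBlocksDom.comp Primrec.snd).and
      ((primrecRel_haltingBlocksLT.comp hx Primrec.snd).and
        (primrecRel_haltingBlocksLT.comp Primrec.snd (Primrec.snd.comp Primrec.fst)))
  classical
  have hfind : Partrec fun p : ℕ × ℕ => Nat.rfind fun n => Part.some (decide (R p n)) :=
    Partrec.rfind hR.decide.to_comp.partrec.to₂
  have hspec : ∀ {x n}, n ∈ (ψ.toPFun x).bind (fun y => Nat.rfind fun n =>
      Part.some (decide (R (x, y) n))) → ∃ y ∈ ψ.toPFun x, R (x, y) n := fun {x n} hn => by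
    obtain ⟨y, hy, hn⟩ := Part.mem_bind_iff.1 hn
    exact ⟨y, hy, by simpa using Nat.rfind_spec hn⟩
  have hdom : AlmostSubset C {x | ((ψ.toPFun x).bind fun y => Nat.rfind fun n =>
      Part.some (decide (R (x, y) n))).Dom} := by
    -- Block `x` records the program of `ψ` only once `x` exceeds its index; this excludes finitely
    -- many `x`.
    have hlarge : AlmostSubset C {x | Encodable.encode c < x} :=
      (Set.finite_le_nat (Encodable.encode c)).subset fun x hx => by
        simpa using hx.2
    refine (AlmostSubset.inter hφq hlarge).mono ?_
    rintro x ⟨⟨a, y, ha, hy, hay⟩, hx⟩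
    rw [Part.mem_some_iff.1 ha] at hay
    obtain ⟨n, hn⟩ := exists_between_haltingBlocks (y := y) hx
      (by rwa [Denumerable.ofNat_encode, hc]) hay
    refine Part.dom_iff_mem.2 ?_
    obtain ⟨m, hm, -⟩ := Nat.rfind_min' (p := fun n => decide (R (x, y) n)) (decide_eq_true hn)
    exact ⟨m, Part.mem_bind hy hm⟩
  -- The search result lies strictly between `(x, 0)` and `ψ x` wherever it is defined, so `θ`
  -- refutes that `ψ` is an immediate successor.
  let θ : haltingBlocks.PreCohesivePower C :=
    { toPFun := fun x => (ψ.toPFun x).bind fun y => Nat.rfind fun n =>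
        Part.some (decide (R (x, y) n))
      partrec := ψ.partrec.bind hfind.to₂
      mem_dom := fun x n hn => by
        obtain ⟨y, -, h⟩ := hspec hn
        exact h.1
      almost_defined := hdom }
  refine hq ⟨Quotient.mk _ θ, hdom.mono fun x hx => ?_, hdom.mono fun x hx => ?_⟩
  · obtain ⟨n, hn⟩ := Part.dom_iff_mem.1 hx
    obtain ⟨y, -, h⟩ := hspec hn
    exact ⟨_, n, Part.mem_some _, hn, h.2.1⟩
  · obtain ⟨n, hn⟩ := Part.dom_iff_mem.1 hx
    obtain ⟨y, hy, h⟩ := hspec hn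
    exact ⟨n, y, hn, hy, h.2.2⟩

theorem mainTheorem7 :
    ∃ (C : Set ℕ) (L : ComputableLinearOrder) (Φ : strictOrderLang.Sentence),
      IsCohesive C ∧
      IsSigmaFormula 3 Φ ∧
      -- `Φ` expresses that some element has no immediate successor
      (∀ (M : Type) (r : M → M → Prop),
        @FirstOrder.Language.Sentence.Realize strictOrderLang M (relStructure r) Φ ↔
          ∃ x : M, ¬ ∃ y : M, IsImmediateSuccessor r x y) ∧
      L.CohesivePower C ⊨ Φ ∧
      ¬ L.Carrier ⊨ Φ := by
  obtain ⟨C, hC⟩ := exists_isCohesive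
  refine ⟨C, haltingBlocks, noImmediateSuccessorSentence, hC,
    isSigmaFormula_noImmediateSuccessorSentence, realize_noImmediateSuccessorSentence, ?_, ?_⟩
  · exact (realize_noImmediateSuccessorSentence _ _).2
      (exists_no_immediateSuccessor_cohesivePower_haltingBlocks C)
  · intro h
    obtain ⟨x, hx⟩ := (realize_noImmediateSuccessorSentence haltingBlocks.Carrier
      fun a b => haltingBlocksLT a.1 b.1).1 h
    obtain ⟨b, hb, hxb, hno⟩ := exists_isImmediateSuccessor_haltingBlocks x.1
    exact hx ⟨⟨b, hb⟩, hxb, fun ⟨c, hxc, hcb⟩ => hno ⟨c.1, c.2, hxc, hcb⟩⟩
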